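/- \textbf{Model.} Let $A$ be a Normal linear sociability network with $n$ nodes, $K_*$ communities and constant error variance $\sigma^2\ge 0$: $A$ is a random symmetric $n\times n$ matrix with zero diagonal and, for $u\ne v$ in communities $i$ and $j$, $$A_{uv}=\gamma_{ij}+\alpha_{ij}Z_u^{(j)}+\beta_{ij}Z_v^{(i)}+\sigma\,\epsilon_{uv},\qquad \gamma_{ij}=\gamma_{ji},\quad \beta_{ij}=\alpha_{ji},\quad \epsilon_{uv}=\epsilon_{vu}.$$ Here $\gamma_{ij},\alpha_{ij}\in\mathbb R$; the sociabilities $Z_u^{(j)}$ are $\mathcal N(0,1)$ and independent across nodes $u$ (for one node they may depend on each other, e.g. $Z_u^{(j)}=Z_u$ for all $j$); and the $\epsilon_{uv}$, $u<v$, are i.i.d. $\mathcal N(0,1)$, independent of the sociabilities. Let $P_*$ be the same network with $\sigma$ replaced by $0$. \textbf{Estimator.} For constants $C_1,C_2,C_3>0$ put $$\mathrm{Pen}(n,K)=4\big(C_1nK+C_2K^2\log n+C_3(\log n+n\log K)\big),$$ and call $K$ admissible if $$C_1nK+C_2K^2\log n+C_3(\log n+n\log K)\le \frac{n(n-1)}4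 .$$ A clustering of the nodes into $\hat K$ non-empty communities induces the estimate $\hat P$ that minimizes $\|A-P\|_F$ over all matrices $P$ of the above form with $\sigma=0$ and these communities (arbitrary real $\gamma,\alpha,Z$). Let $\hat P$ be the estimate induced by a clustering which, among all clusterings with an admissible number $\hat K$ of communities, minimizes $$\|A-\hat P\|_F^2+\hat\sigma^2\,\mathrm{Pen}(n,\hat K),\qquad \hat\sigma^2=\frac{\|A-\hat P\|_F^2}{n(n-1)} .$$ \textbf{Theorem.} There are constants $C_1,C_2>0$ and, for every $0<c<1$, constants $C_3,C>0$ depending only on $c$, such that for every network as above whose number of communities $K_*$ is admissible, and for all $t>0$ and $\epsilon\in[0,1/2)$, $$\mathbb P\Big(\|P_*-\hat P\|_F^2\le \frac{\sigma^2}{1-c}\big(Ct+(1+\epsilon)\,\mathrm{Pen}(n,K_*)\big)\Big)\ \ge\ 1-3e^{-t}-e^{-\frac3{32}\epsilon^2n(n-1)} .$$ -/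

import Mathlib

/-- The adjacency matrix of a linear sociability network on the nodes `Fin n`.

* `z u` is the community of node `u`;
* `γ s(i, j)` is the intercept of the subnetwork joining the communities `i` and `j`;
* `α i j` is the slope, in that subnetwork, of the sociability of the endpoint lying in `i`.
  The network is undirected, so the slope of the endpoint lying in `j` (usually written `β i j`)
  is `α j i`; inside a community both slopes are `α i i`;
* `Z u j` is the sociability of node `u` for its edges towards community `j` (a single global
  sociability is the case where `Z u j` does not depend on `j`);
* `σ` is the noise level and `ξ s(u, v)` the error on the edge between `u` and `v`.

There are no self-loops, so the diagonal vanishes. -/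
def lsmNetwork {n K : ℕ} (z : Fin n → Fin K) (γ : Sym2 (Fin K) → ℝ) (α : Fin K → Fin K → ℝ)
    (Z : Fin n → Fin K → ℝ) (σ : ℝ) (ξ : Sym2 (Fin n) → ℝ) : Matrix (Fin n) (Fin n) ℝ :=
  Matrix.of fun u v =>
    if u = v then 0
    else γ s(z u, z v) + α (z u) (z v) * Z u (z v) + α (z v) (z u) * Z v (z u) + σ * ξ s(u, v)

/-- The random inputs of the Normal linear sociability model on a probability space `(Ω, μ)`:
standard normal sociabilities, independent from one node to the other, and i.i.d. standard normal
errors on the edges (unordered pairs of distinct nodes), independent of the sociabilities.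
The sociabilities `Z u j`, `j : Fin K`, of one and the same node may depend on each other in any
way; in particular they may all be equal. -/
structure IsNormalLSMInput {Ω : Type*} [MeasurableSpace Ω] (μ : MeasureTheory.Measure Ω) {n K : ℕ}
    (Z : Fin n → Fin K → Ω → ℝ) (ξ : Sym2 (Fin n) → Ω → ℝ) : Prop where
  sociability_law : ∀ u j, ProbabilityTheory.HasLaw (Z u j) (ProbabilityTheory.gaussianReal 0 1) μ
  sociability_indep :
    ProbabilityTheory.iIndepFun (fun (u : Fin n) (ω : Ω) (j : Fin K) => Z u j ω) μ
  error_law : ∀ e : Sym2 (Fin n), ¬ e.IsDiag →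
    ProbabilityTheory.HasLaw (ξ e) (ProbabilityTheory.gaussianReal 0 1) μ
  error_indep :
    ProbabilityTheory.iIndepFun (fun e : {e : Sym2 (Fin n) // ¬ e.IsDiag} => ξ e.1) μ
  sociability_error_indep :
    ProbabilityTheory.IndepFun (fun (ω : Ω) (u : Fin n) (j : Fin K) => Z u j ω)
      (fun (ω : Ω) (e : {e : Sym2 (Fin n) // ¬ e.IsDiag}) => ξ e.1 ω) μ

/-- The squared Frobenius norm. -/
def frobSq {n : ℕ} (M : Matrix (Fin n) (Fin n) ℝ) : ℝ := ∑ u, ∑ v, M u v ^ 2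

section
attribute [local instance] Matrix.frobeniusNormedAddCommGroup

theorem frobSq_eq_norm_sq {n : ℕ} (M : Matrix (Fin n) (Fin n) ℝ) : frobSq M = ‖M‖ ^ 2 := by
  have h : (0 : ℝ) ≤ ∑ u, ∑ v, M u v ^ 2 := by positivity
  rw [Matrix.frobenius_norm_def, ← Real.sqrt_eq_rpow]
  simp only [Real.rpow_ofNat, Real.norm_eq_abs, sq_abs]
  rw [Real.sq_sqrt h, frobSq]

end

/-- The complexity `C₁ n K + C₂ K² log n + C₃ (log n + n log K)` of clusterings of `n` nodes into
`K` communities. -/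
noncomputable def complexity (C₁ C₂ C₃ : ℝ) (n K : ℕ) : ℝ :=
  C₁ * n * K + C₂ * (K : ℝ) ^ 2 * Real.log n + C₃ * (Real.log n + n * Real.log K)

/-- The penalty `Pen(n, K)`. -/
noncomputable def penalty (C₁ C₂ C₃ : ℝ) (n K : ℕ) : ℝ := 4 * complexity C₁ C₂ C₃ n K

/-- The restriction on the number `K` of communities of a network with `n` nodes. -/
def IsAdmissible (C₁ C₂ C₃ : ℝ) (n K : ℕ) : Prop :=
  complexity C₁ C₂ C₃ n K ≤ (n : ℝ) * ((n : ℝ) - 1) / 4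

/-- The estimate of the noise variance attached to the fit `P` of the network `A`. -/
noncomputable def sigmaHatSq {n : ℕ} (A P : Matrix (Fin n) (Fin n) ℝ) : ℝ :=
  frobSq (A - P) / ((n : ℝ) * ((n : ℝ) - 1))

/-- The criterion `‖A - P‖_F² + σ̂² Pen(n, K)`. -/
noncomputable def criterion (C₁ C₂ C₃ : ℝ) {n : ℕ} (A P : Matrix (Fin n) (Fin n) ℝ) (K : ℕ) : ℝ :=
  frobSq (A - P) + sigmaHatSq A P * penalty C₁ C₂ C₃ n K

/-- The noise-free linear sociability networks with community assignment `z`. -/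
def noiselessNetworks {n K : ℕ} (z : Fin n → Fin K) : Set (Matrix (Fin n) (Fin n) ℝ) :=
  {P | ∃ (γ : Sym2 (Fin K) → ℝ) (α : Fin K → Fin K → ℝ) (Z : Fin n → Fin K → ℝ),
    P = lsmNetwork z γ α Z 0 0}

/-- `P` is the estimate of the network `A` induced by the clustering `z`: the noise-free linear
sociability network with communities `z` which is closest to `A` in Frobenius norm. -/
def IsInducedEstimate {n K : ℕ} (A : Matrix (Fin n) (Fin n) ℝ) (z : Fin n → Fin K)
    (P : Matrix (Fin n) (Fin n) ℝ) : Prop :=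
  P ∈ noiselessNetworks z ∧ ∀ Q ∈ noiselessNetworks z, frobSq (A - P) ≤ frobSq (A - Q)

/-- `P` is induced by a clustering of the nodes which minimizes the penalized criterion among all
clusterings into an admissible number of (non-empty) communities. -/
def IsPenalizedEstimate (C₁ C₂ C₃ : ℝ) {n : ℕ} (A P : Matrix (Fin n) (Fin n) ℝ) : Prop :=
  ∃ (Khat : ℕ) (zhat : Fin n → Fin Khat), Function.Surjective zhat ∧
    IsAdmissible C₁ C₂ C₃ n Khat ∧ IsInducedEstimate A zhat P ∧
    ∀ (K : ℕ) (z : Fin n → Fin K) (Q : Matrix (Fin n) (Fin n) ℝ), Function.Surjective z →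
      IsAdmissible C₁ C₂ C₃ n K → IsInducedEstimate A z Q →
      criterion C₁ C₂ C₃ A P Khat ≤ criterion C₁ C₂ C₃ A Q K

open MeasureTheory ProbabilityTheory WithLp
open scoped RealInnerProductSpace

/-! Record a network by its vector of edge weights. With the sociabilities free, the noiseless
networks with given communities form a linear space of dimension at most `n * K`
(`noiselessNetworks_eq_image`), so an induced estimate is an orthogonal projection
(`isInducedEstimate_networkOfEdges_iff`). Its loss splits exactly into a squared bias and `σ ^ 2`
times the squared norm of the projected noise.

The selected clustering depends on the data, so the noise is controlled for all clusterings at once.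
A clustering into `K` communities gets weight `1 / (n * K ^ n)`; these weights sum to one, and the
price of the union bound is `log n + n * log K`, the third term of the penalty. The sociabilities
make the bias vectors random, but independent of the noise, so the cross terms are Gaussian given
the bias.

What remains is deterministic (`oracle_arithmetic`). The selected clustering is compared with the
true communities, whose residual is at most that of the noise itself. As `σ̂²` is itself a residual,
an upper bound on the noise norm controls the true penalty, and a lower bound makes the selected
penalty large enough to pay for overfitting. The cross term is absorbed by a fraction `c` of the
bias, whence the factor `1 / (1 - c)`. -/

/-! ### Tail bounds for the standard Gaussian measure -/

theorem log_one_add_le_sub_sq {x : ℝ} (h0 : 0 ≤ x) (h1 : x ≤ 1 / 2) :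
    Real.log (1 + x) ≤ x - 3 / 8 * x ^ 2 := by
  -- The rational function is a Padé approximant of `log (1 + y)`. It lies below `y - 3 / 8 * y ^ 2`
  -- exactly up to `y = 1 / 2`, which fixes the constant `3 / 8`.
  have hmono : MonotoneOn (fun y : ℝ => y * (6 + y) / (6 + 4 * y) - Real.log (1 + y))
      (Set.Ici 0) := by
    have hder : ∀ y : ℝ, 0 ≤ y → HasDerivAt
        (fun y : ℝ => y * (6 + y) / (6 + 4 * y) - Real.log (1 + y))
        (4 * y ^ 3 / ((6 + 4 * y) ^ 2 * (1 + y))) y := fun y hy => by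
      have hy1 : 6 + 4 * y ≠ 0 := by positivity
      have hy2 : 1 + y ≠ 0 := by positivity
      have hid := hasDerivAt_id y
      refine (((hid.mul (hid.const_add 6)).div ((hid.const_mul 4).const_add 6) hy1).sub
        ((hid.const_add 1).log hy2)).congr_deriv ?_
      simp only [id, Pi.mul_apply]
      field_simp
      ring
    refine monotoneOn_of_deriv_nonneg (convex_Ici 0)
      (fun y hy => (hder y hy).continuousAt.continuousWithinAt)
      (fun y hy => (hder y (interior_subset hy)).differentiableAt.differentiableWithinAt)
      fun y hy => ?_
    have hy' : 0 ≤ y := interior_subset hy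
    rw [(hder y hy').deriv]
    positivity
  have h := hmono Set.self_mem_Ici h0 h0
  simp only [zero_mul, add_zero, zero_div, Real.log_one, sub_zero, sub_nonneg] at h
  refine h.trans ?_
  rw [div_le_iff₀ (by positivity)]
  nlinarith [mul_nonneg (sq_nonneg x) (sub_nonneg.2 h1)]

theorem integrable_exp_mul_sq_gaussianReal {s : ℝ} (hs : s < 1 / 2) :
    Integrable (fun x : ℝ => Real.exp (s * x ^ 2)) (gaussianReal 0 1) := by
  rw [gaussianReal_of_var_ne_zero 0 one_ne_zero,
    integrable_withDensity_iff (measurable_gaussianPDF 0 1) (ae_of_all _ fun _ => gaussianPDF_lt_top)]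
  have h := (integrable_exp_neg_mul_sq (b := 1 / 2 - s) (by linarith)).const_mul
    ((Real.sqrt (2 * Real.pi))⁻¹)
  refine h.congr (ae_of_all _ fun x => ?_)
  simp only [toReal_gaussianPDF, gaussianPDFReal, NNReal.coe_one, mul_one, sub_zero]
  rw [mul_comm (Real.exp _), mul_assoc, ← Real.exp_add]
  ring_nf

theorem integral_exp_mul_sq_gaussianReal {s : ℝ} (hs : s < 1 / 2) :
    ∫ x : ℝ, Real.exp (s * x ^ 2) ∂gaussianReal 0 1 = (Real.sqrt (1 - 2 * s))⁻¹ := by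
  rw [integral_gaussianReal_eq_integral_smul one_ne_zero]
  have h : ∀ x : ℝ, gaussianPDFReal 0 1 x • Real.exp (s * x ^ 2) =
      (Real.sqrt (2 * Real.pi))⁻¹ * Real.exp (-(1 / 2 - s) * x ^ 2) := by
    intro x
    simp only [gaussianPDFReal, NNReal.coe_one, mul_one, sub_zero, smul_eq_mul]
    rw [mul_assoc, ← Real.exp_add]
    ring_nf
  simp_rw [h]
  rw [integral_const_mul, integral_gaussian, ← Real.sqrt_inv, ← Real.sqrt_inv,
    ← Real.sqrt_mul (by positivity)]
  congr 1
  have : 1 - 2 * s ≠ 0 := by linarith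
  have : 1 / 2 - s ≠ 0 := by linarith
  field_simp

theorem exp_mul_norm_sq_sum_orthonormalBasis {E ι : Type*} [NormedAddCommGroup E]
    [InnerProductSpace ℝ E] [Fintype ι] (b : OrthonormalBasis ι ℝ E)
    (s : ℝ) (x : ι → ℝ) :
    Real.exp (s * ‖∑ i, x i • b i‖ ^ 2) = ∏ i, Real.exp (s * x i ^ 2) := by
  rw [← Real.exp_sum, ← Finset.mul_sum, ← b.sum_sq_norm_inner_right]
  congr 2
  refine Finset.sum_congr rfl fun i _ => ?_
  simp [b.orthonormal.inner_right_fintype]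

section
variable {E : Type*} [NormedAddCommGroup E] [InnerProductSpace ℝ E] [FiniteDimensional ℝ E]
  [MeasurableSpace E] [BorelSpace E]

theorem integrable_exp_mul_norm_sq_stdGaussian {s : ℝ} (hs : s < 1 / 2) :
    Integrable (fun x : E => Real.exp (s * ‖x‖ ^ 2)) (stdGaussian E) := by
  rw [stdGaussian_eq_map_pi_orthonormalBasis (stdOrthonormalBasis ℝ E),
    integrable_map_measure (by fun_prop) (Measurable.aemeasurable (by fun_prop))]
  simp only [Function.comp_def, exp_mul_norm_sq_sum_orthonormalBasis]
  exact Integrable.fintype_prod fun _ => integrable_exp_mul_sq_gaussianReal hs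

theorem mgf_norm_sq_stdGaussian {s : ℝ} (hs : s < 1 / 2) :
    mgf (fun x : E => ‖x‖ ^ 2) (stdGaussian E) s =
      Real.exp (-(Module.finrank ℝ E / 2 * Real.log (1 - 2 * s))) := by
  have hpos : 0 < 1 - 2 * s := by linarith
  have hexp : Real.exp (-(Module.finrank ℝ E / 2 * Real.log (1 - 2 * s))) =
      (Real.sqrt (1 - 2 * s))⁻¹ ^ Module.finrank ℝ E := by
    rw [← Real.exp_log (Real.sqrt_pos.2 hpos), ← Real.exp_neg, ← Real.exp_nat_mul,
      Real.log_sqrt hpos.le]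
    ring_nf
  rw [hexp]
  rw [mgf, stdGaussian_eq_map_pi_orthonormalBasis (stdOrthonormalBasis ℝ E),
    integral_map (Measurable.aemeasurable (by fun_prop)) (by fun_prop)]
  simp only [exp_mul_norm_sq_sum_orthonormalBasis]
  rw [integral_fintype_prod_eq_prod (𝕜 := ℝ) (fun _ x => Real.exp (s * x ^ 2))]
  simp [integral_exp_mul_sq_gaussianReal hs]

/-- Characteristic functions agree, because pairing with a vector of `S` does not see the component
orthogonal to `S`. -/
theorem stdGaussian_map_orthogonalProjectionOnto (S : Submodule ℝ E) :
    (stdGaussian E).map S.orthogonalProjectionOnto = stdGaussian S := by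
  have : IsProbabilityMeasure ((stdGaussian E).map S.orthogonalProjectionOnto) :=
    Measure.isProbabilityMeasure_map (by fun_prop)
  refine Measure.ext_of_charFun ?_
  ext v
  rw [charFun_stdGaussian, charFun_apply, integral_map (by fun_prop) (by fun_prop)]
  have h : ∀ x : E, ⟪S.orthogonalProjectionOnto x, v⟫ = ⟪x, (v : E)⟫ := fun x => by
    rw [← Submodule.inner_orthogonalProjectionOnto_eq_of_mem_right]
  simp_rw [h]
  rw [← charFun_apply, charFun_stdGaussian]
  simp

/-- Chernoff's bound at the optimal exponent, the `s` with `1 - 2 * s = (1 + ε)⁻¹`. -/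
theorem stdGaussian_real_norm_sq_ge_le {ε : ℝ} (h0 : 0 ≤ ε) (h1 : ε ≤ 1 / 2) :
    (stdGaussian E).real {x | Module.finrank ℝ E * (1 + ε) ≤ ‖x‖ ^ 2} ≤
      Real.exp (-(3 / 16 * ε ^ 2 * Module.finrank ℝ E)) := by
  have hs : ε / (2 * (1 + ε)) < 1 / 2 := by
    rw [div_lt_div_iff₀ (by linarith) (by norm_num)]
    linarith
  refine (measure_ge_le_exp_mul_mgf _ (by positivity : 0 ≤ ε / (2 * (1 + ε)))
    (integrable_exp_mul_norm_sq_stdGaussian hs)).trans ?_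
  have hε : 1 + ε ≠ 0 := by linarith
  have h2 : 1 - 2 * (ε / (2 * (1 + ε))) = (1 + ε)⁻¹ := by
    field_simp
    ring
  have h3 : -(ε / (2 * (1 + ε))) * (Module.finrank ℝ E * (1 + ε)) =
      -(Module.finrank ℝ E / 2 * ε) := by
    field_simp
  rw [mgf_norm_sq_stdGaussian hs, ← Real.exp_add, h2, h3, Real.log_inv, Real.exp_le_exp]
  have h4 := mul_le_mul_of_nonneg_left (log_one_add_le_sub_sq h0 h1)
    (by positivity : (0 : ℝ) ≤ Module.finrank ℝ E / 2)
  linarith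

/-- Chernoff's bound at `s = -1 / 2`: the dimension drops out because `log 2 ≥ 1 / 2`. -/
theorem stdGaussian_real_norm_sq_le_le (t : ℝ) :
    (stdGaussian E).real {x | ‖x‖ ^ 2 ≤ Module.finrank ℝ E / 2 - 2 * t} ≤ Real.exp (-t) := by
  refine (measure_le_le_exp_mul_mgf _ (by norm_num : (-1 / 2 : ℝ) ≤ 0)
    (integrable_exp_mul_norm_sq_stdGaussian (by norm_num))).trans ?_
  rw [mgf_norm_sq_stdGaussian (by norm_num), ← Real.exp_add, Real.exp_le_exp,
    show (1 : ℝ) - 2 * (-1 / 2) = 2 by norm_num]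
  have h := mul_le_mul_of_nonneg_left (by linarith [Real.log_two_gt_d9] : 1 / 2 ≤ Real.log 2)
    (by positivity : (0 : ℝ) ≤ Module.finrank ℝ E / 2)
  linarith

/-- Chernoff's bound at `s = 1 / 4`: the dimension drops out because `log 2 ≤ 1`. -/
theorem stdGaussian_real_norm_sq_ge_le_exp_neg {d : ℕ} (hd : Module.finrank ℝ E ≤ d) (t : ℝ) :
    (stdGaussian E).real {x | 2 * d + 4 * t ≤ ‖x‖ ^ 2} ≤ Real.exp (-t) := by
  refine (measure_ge_le_exp_mul_mgf _ (by norm_num : (0 : ℝ) ≤ 1 / 4)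
    (integrable_exp_mul_norm_sq_stdGaussian (by norm_num))).trans ?_
  rw [mgf_norm_sq_stdGaussian (by norm_num), ← Real.exp_add, Real.exp_le_exp,
    show (1 : ℝ) - 2 * (1 / 4) = 2⁻¹ by norm_num, Real.log_inv]
  have h := mul_le_mul_of_nonneg_left (by linarith [Real.log_two_lt_d9] : Real.log 2 ≤ 1)
    (by positivity : (0 : ℝ) ≤ Module.finrank ℝ E / 2)
  have hd' : (Module.finrank ℝ E : ℝ) ≤ d := by exact_mod_cast hd
  linarith

theorem stdGaussian_real_norm_sq_orthogonalProjectionOnto_ge_le (S : Submodule ℝ E) {d : ℕ}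
    (hd : Module.finrank ℝ S ≤ d) (t : ℝ) :
    (stdGaussian E).real {x | 2 * d + 4 * t ≤ ‖S.orthogonalProjectionOnto x‖ ^ 2} ≤
      Real.exp (-t) := by
  have h := stdGaussian_real_norm_sq_ge_le_exp_neg hd t
  rwa [← stdGaussian_map_orthogonalProjectionOnto, map_measureReal_apply (by fun_prop)
    (measurableSet_le (by fun_prop) (by fun_prop))] at h

theorem stdGaussian_map_inner (a : E) :
    (stdGaussian E).map (fun x => ⟪a, x⟫) = gaussianReal 0 (‖a‖₊ ^ 2) := by
  have h := IsGaussian.map_eq_gaussianReal (μ := stdGaussian E) (innerSL ℝ a)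
  rw [integral_strongDual_stdGaussian, variance_dual_stdGaussian, innerSL_apply_norm] at h
  rwa [Real.toNNReal_pow (norm_nonneg a), norm_toNNReal] at h

theorem stdGaussian_real_inner_ge_le (a : E) {t : ℝ} (ht : 0 ≤ t) (ha : a ≠ 0) :
    (stdGaussian E).real {x | Real.sqrt (2 * t) * ‖a‖ ≤ ⟪a, x⟫} ≤ Real.exp (-t) := by
  have ha' : 0 < ‖a‖ := norm_pos_iff.2 ha
  have hmap := stdGaussian_map_inner a
  have hint : Integrable (fun x => Real.exp (Real.sqrt (2 * t) / ‖a‖ * ⟪a, x⟫))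
      (stdGaussian E) := by
    have h := integrable_exp_mul_gaussianReal (μ := 0) (v := ‖a‖₊ ^ 2) (Real.sqrt (2 * t) / ‖a‖)
    rw [← hmap, integrable_map_measure (by fun_prop) (by fun_prop)] at h
    exact h
  refine (measure_ge_le_exp_mul_mgf _ (by positivity) hint).trans ?_
  rw [mgf_gaussianReal hmap, ← Real.exp_add, Real.exp_le_exp]
  have h1 : Real.sqrt (2 * t) ^ 2 = 2 * t := Real.sq_sqrt (by linarith)
  push_cast
  rw [div_pow, h1]
  field_simp
  nlinarith

/-- The strict inequality makes the event empty for `a = 0`, so a vanishing bias needs no separate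
treatment later. -/
theorem stdGaussian_real_inner_sq_gt_le (a : E) {t : ℝ} (ht : 0 ≤ t) :
    (stdGaussian E).real {x | 2 * t * ‖a‖ ^ 2 < ⟪a, x⟫ ^ 2} ≤ 2 * Real.exp (-t) := by
  rcases eq_or_ne a 0 with rfl | ha
  · simp [Real.exp_nonneg]
  refine (measureReal_mono (s₂ := {x | Real.sqrt (2 * t) * ‖a‖ ≤ ⟪a, x⟫} ∪
    {x | Real.sqrt (2 * t) * ‖-a‖ ≤ ⟪-a, x⟫}) fun x hx => ?_).trans
      ((measureReal_union_le _ _).trans ?_)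
  · have h1 : (Real.sqrt (2 * t) * ‖a‖) ^ 2 ≤ ⟪a, x⟫ ^ 2 := by
      rw [mul_pow, Real.sq_sqrt (by linarith)]
      exact le_of_lt hx
    have h2 := sq_le_sq.1 h1
    rw [abs_of_nonneg (by positivity), le_abs] at h2
    simpa [inner_neg_left] using h2
  · rw [two_mul (Real.exp _)]
    exact add_le_add (stdGaussian_real_inner_ge_le a ht ha)
      (stdGaussian_real_inner_ge_le (-a) ht (neg_ne_zero.2 ha))
end

/-! ### Bias, variance and residual of an orthogonal projection -/

section
variable {E : Type*} [NormedAddCommGroup E] [InnerProductSpace ℝ E] (S : Submodule ℝ E)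
  [S.HasOrthogonalProjection]

theorem inner_sub_starProjection_starProjection (x y : E) :
    ⟪x - S.starProjection x, S.starProjection y⟫ = 0 :=
  S.starProjection_inner_eq_zero x _ (S.starProjection_apply_mem y)

theorem norm_sub_sq_eq_add_of_mem (y : E) {q : E} (hq : q ∈ S) :
    ‖y - q‖ ^ 2 = ‖y - S.starProjection y‖ ^ 2 + ‖S.starProjection y - q‖ ^ 2 := by
  have h : ⟪y - S.starProjection y, S.starProjection y - q⟫ = 0 :=
    S.starProjection_inner_eq_zero y _ (S.sub_mem (S.starProjection_apply_mem y) hq)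
  rw [← sub_add_sub_cancel y (S.starProjection y) q, norm_add_sq_real, h]
  ring

theorem norm_sub_starProjection_add_smul_sq (p x : E) (σ : ℝ) :
    ‖p - S.starProjection (p + σ • x)‖ ^ 2 =
      ‖p - S.starProjection p‖ ^ 2 + σ ^ 2 * ‖S.starProjection x‖ ^ 2 := by
  have h : p - S.starProjection (p + σ • x) =
      (p - S.starProjection p) - σ • S.starProjection x := by
    rw [map_add, map_smul]
    abel
  rw [h, norm_sub_sq_real, inner_smul_right, inner_sub_starProjection_starProjection, norm_smul,
    mul_pow, Real.norm_eq_abs, sq_abs]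
  ring

theorem norm_add_smul_sub_starProjection_sq (p x : E) (σ : ℝ) :
    ‖p + σ • x - S.starProjection (p + σ • x)‖ ^ 2 =
      ‖p - S.starProjection p‖ ^ 2 + 2 * σ * ⟪p - S.starProjection p, x⟫ +
        σ ^ 2 * (‖x‖ ^ 2 - ‖S.starProjection x‖ ^ 2) := by
  have h : p + σ • x - S.starProjection (p + σ • x) =
      (p - S.starProjection p) + σ • (x - S.starProjection x) := by
    rw [map_add, map_smul, smul_sub]
    abel
  have h2 := norm_sub_sq_eq_add_of_mem S x S.zero_mem
  rw [sub_zero, sub_zero] at h2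
  rw [h, norm_add_sq_real, inner_smul_right, inner_sub_right,
    inner_sub_starProjection_starProjection, norm_smul, mul_pow, Real.norm_eq_abs, sq_abs, h2]
  ring
end

/-! ### Networks as vectors of edge weights -/

/-- The unordered pairs of distinct nodes. -/
abbrev Edge (n : ℕ) : Type := {e : Sym2 (Fin n) // ¬ e.IsDiag}

/-- The network with given edge weights. -/
noncomputable def networkOfEdges {n : ℕ} (x : EuclideanSpace ℝ (Edge n)) :
    Matrix (Fin n) (Fin n) ℝ :=
  Matrix.of fun u v => if h : u = v then 0 else x ⟨s(u, v), by simpa using h⟩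

theorem networkOfEdges_sub {n : ℕ} (x y : EuclideanSpace ℝ (Edge n)) :
    networkOfEdges x - networkOfEdges y = networkOfEdges (x - y) := by
  ext u v
  by_cases h : u = v <;> simp [networkOfEdges, h]

theorem sum_sum_eq_two_mul_sum_edge {n : ℕ} (f : Sym2 (Fin n) → ℝ) :
    ∑ u, ∑ v, (if u = v then 0 else f s(u, v)) = 2 * ∑ e : Edge n, f e.1 := by
  have h1 : ∑ e : Edge n, f e.1 = ∑ u, ∑ v, if u < v then f s(u, v) else 0 := by
    have h := Finset.sum_sym2_filter_not_isDiag (Finset.univ : Finset (Fin n)) f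
    rw [Finset.sum_subtype (p := fun e : Sym2 (Fin n) => ¬ e.IsDiag) _ (by simp)] at h
    rw [h, ← Finset.sum_product', ← Finset.sum_filter]
    refine Finset.sum_congr ?_ fun _ _ => rfl
    ext ⟨u, v⟩
    simpa using fun h => ne_of_lt h
  have h2 : ∑ u, ∑ v, (if v < u then f s(u, v) else 0) =
      ∑ u, ∑ v, if u < v then f s(u, v) else 0 := by
    rw [Finset.sum_comm]
    simp only [Sym2.eq_swap]
  rw [h1, two_mul]
  nth_rw 1 [← h2]
  rw [← Finset.sum_add_distrib]
  refine Finset.sum_congr rfl fun u _ => ?_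
  rw [← Finset.sum_add_distrib]
  refine Finset.sum_congr rfl fun v _ => ?_
  rcases lt_trichotomy u v with h | h | h
  · simp [h, h.ne, h.not_gt]
  · simp [h]
  · simp [h, h.ne', h.not_gt]

theorem frobSq_networkOfEdges {n : ℕ} (x : EuclideanSpace ℝ (Edge n)) :
    frobSq (networkOfEdges x) = 2 * ‖x‖ ^ 2 := by
  rw [EuclideanSpace.real_norm_sq_eq]
  have h := sum_sum_eq_two_mul_sum_edge
    (fun e : Sym2 (Fin n) => if h : e.IsDiag then 0 else x ⟨e, h⟩ ^ 2)
  rw [frobSq]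
  convert h using 4 with u _ v _ e _
  · by_cases huv : u = v <;> simp [networkOfEdges, huv]
  · simp [e.2]

/-- The edge weights of the noiseless network where the edge between `u` and `v` has weight
`a u (z v) + a v (z u)`. -/
noncomputable def communityEdges {n K : ℕ} (z : Fin n → Fin K) :
    (Fin n → Fin K → ℝ) →ₗ[ℝ] EuclideanSpace ℝ (Edge n) where
  toFun a := toLp 2 fun e =>
    Sym2.lift ⟨fun u v => a u (z v) + a v (z u), fun _ _ => add_comm _ _⟩ e.1
  map_add' a b := by
    ext ⟨e, he⟩
    induction e with | _ u v
    simp only [Sym2.lift_mk, PiLp.add_apply, Pi.add_apply]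
    ring
  map_smul' r a := by
    ext ⟨e, he⟩
    induction e with | _ u v
    simp only [Sym2.lift_mk, PiLp.smul_apply, Pi.smul_apply, smul_eq_mul, RingHom.id_apply]
    ring

/-- The edge weights of the noiseless networks with communities `z`. -/
noncomputable def communitySpace {n K : ℕ} (z : Fin n → Fin K) :
    Submodule ℝ (EuclideanSpace ℝ (Edge n)) :=
  LinearMap.range (communityEdges z)

theorem finrank_communitySpace_le {n K : ℕ} (z : Fin n → Fin K) :
    Module.finrank ℝ (communitySpace z) ≤ n * K := by
  refine (LinearMap.finrank_range_le _).trans ?_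
  simp [Module.finrank_pi_fintype]

/-- The coefficients of a linear sociability network in its space of noiseless networks. -/
noncomputable def sociabilityCoeff {n K : ℕ} (z : Fin n → Fin K) (γ : Sym2 (Fin K) → ℝ)
    (α : Fin K → Fin K → ℝ) (Z : Fin n → Fin K → ℝ) : Fin n → Fin K → ℝ :=
  fun u j => γ s(z u, j) / 2 + α (z u) j * Z u j

theorem lsmNetwork_eq_networkOfEdges {n K : ℕ} (z : Fin n → Fin K) (γ : Sym2 (Fin K) → ℝ)
    (α : Fin K → Fin K → ℝ) (Z : Fin n → Fin K → ℝ) (σ : ℝ) (ξ : Sym2 (Fin n) → ℝ) :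
    lsmNetwork z γ α Z σ ξ = networkOfEdges
      (communityEdges z (sociabilityCoeff z γ α Z) + σ • toLp 2 fun e : Edge n => ξ e.1) := by
  ext u v
  by_cases h : u = v
  · simp [lsmNetwork, networkOfEdges, h]
  · simp only [lsmNetwork, networkOfEdges, communityEdges, sociabilityCoeff, Matrix.of_apply, h,
      if_false, dite_false, LinearMap.coe_mk, AddHom.coe_mk, PiLp.add_apply, PiLp.smul_apply,
      Sym2.lift_mk, smul_eq_mul, Sym2.eq_swap (a := z v) (b := z u)]
    ring

/-- Half of each symmetric intercept can be moved into either endpoint's term; conversely, zero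
intercepts and unit slopes already realize arbitrary coefficients. The products `α * Z` therefore
cause no nonlinearity. -/
theorem noiselessNetworks_eq_image {n K : ℕ} (z : Fin n → Fin K) :
    noiselessNetworks z = networkOfEdges '' communitySpace z := by
  ext P
  constructor
  · rintro ⟨γ, α, Z, rfl⟩
    refine ⟨communityEdges z (sociabilityCoeff z γ α Z), LinearMap.mem_range_self _ _, ?_⟩
    rw [lsmNetwork_eq_networkOfEdges, zero_smul, add_zero]
  · rintro ⟨_, ⟨a, rfl⟩, rfl⟩
    refine ⟨0, 1, a, ?_⟩
    have h : sociabilityCoeff z 0 1 a = a := by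
      ext u j
      simp [sociabilityCoeff]
    rw [lsmNetwork_eq_networkOfEdges, zero_smul, add_zero, h]

theorem frobSq_networkOfEdges_sub {n : ℕ} (x y : EuclideanSpace ℝ (Edge n)) :
    frobSq (networkOfEdges x - networkOfEdges y) = 2 * ‖x - y‖ ^ 2 := by
  rw [networkOfEdges_sub, frobSq_networkOfEdges]

theorem isInducedEstimate_networkOfEdges_iff {n K : ℕ} (z : Fin n → Fin K)
    (y : EuclideanSpace ℝ (Edge n)) (P : Matrix (Fin n) (Fin n) ℝ) :
    IsInducedEstimate (networkOfEdges y) z P ↔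
      P = networkOfEdges ((communitySpace z).starProjection y) := by
  rw [IsInducedEstimate, noiselessNetworks_eq_image]
  constructor
  · rintro ⟨⟨q, hq, rfl⟩, hmin⟩
    have h := hmin _ ⟨_, (communitySpace z).starProjection_apply_mem y, rfl⟩
    rw [frobSq_networkOfEdges_sub, frobSq_networkOfEdges_sub,
      norm_sub_sq_eq_add_of_mem (communitySpace z) y hq] at h
    have h0 : ‖(communitySpace z).starProjection y - q‖ = 0 := by
      rw [← sq_eq_zero_iff]
      exact le_antisymm (by linarith) (sq_nonneg _)
    rw [sub_eq_zero.1 (norm_eq_zero.1 h0)]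
  · rintro rfl
    refine ⟨⟨_, (communitySpace z).starProjection_apply_mem y, rfl⟩, ?_⟩
    rintro _ ⟨q, hq, rfl⟩
    rw [frobSq_networkOfEdges_sub, frobSq_networkOfEdges_sub,
      norm_sub_sq_eq_add_of_mem (communitySpace z) y hq]
    linarith [sq_nonneg ‖(communitySpace z).starProjection y - q‖]

/-- The true network may have empty communities, whereas the estimator competes only with surjective
clusterings. Discarding the unused labels loses no edge vector. -/
theorem exists_surjective_communitySpace_le {n K : ℕ} (z : Fin n → Fin K) :
    ∃ (K' : ℕ) (z' : Fin n → Fin K'), K' ≤ K ∧ Function.Surjective z' ∧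
      communitySpace z ≤ communitySpace z' := by
  classical
  let e := Fintype.equivFin (Set.range z)
  refine ⟨_, fun u => e ⟨z u, u, rfl⟩, ?_, ?_, ?_⟩
  · exact (Fintype.card_le_of_injective Subtype.val Subtype.val_injective).trans_eq
      (Fintype.card_fin K)
  · intro j
    obtain ⟨⟨_, u, rfl⟩, rfl⟩ := e.surjective j
    exact ⟨u, rfl⟩
  · rintro _ ⟨a, rfl⟩
    refine ⟨fun u j => a u (e.symm j), ?_⟩
    simp [communityEdges]

/-! ### The deterministic oracle inequality -/

theorem complexity_mono {C₁ C₂ C₃ : ℝ} (h₁ : 0 ≤ C₁) (h₂ : 0 ≤ C₂) (h₃ : 0 ≤ C₃) (n : ℕ) :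
    Monotone (complexity C₁ C₂ C₃ n) := by
  intro K K' h
  have hK : (K : ℝ) ≤ K' := by exact_mod_cast h
  have hlog : Real.log K ≤ Real.log K' := by
    rcases Nat.eq_zero_or_pos K with rfl | h0
    · simpa using Real.log_natCast_nonneg K'
    · exact Real.log_le_log (by exact_mod_cast h0) hK
  have := Real.log_natCast_nonneg n
  unfold complexity
  gcongr

theorem complexity_nonneg {C₁ C₂ C₃ : ℝ} (h₁ : 0 ≤ C₁) (h₂ : 0 ≤ C₂) (h₃ : 0 ≤ C₃) (n K : ℕ) :
    0 ≤ complexity C₁ C₂ C₃ n K := by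
  have := Real.log_natCast_nonneg n
  have := Real.log_natCast_nonneg K
  unfold complexity
  positivity

theorem abs_two_mul_le_of_sq_le_mul {g u v : ℝ} (hu : 0 ≤ u) (hv : 0 ≤ v) (h : g ^ 2 ≤ u * v) :
    |2 * g| ≤ u + v := by
  refine abs_le_of_sq_le_sq ?_ (add_nonneg hu hv)
  nlinarith [sq_nonneg (u - v)]

/-- The number of nats needed to describe a clustering of `n` nodes into `K` communities. -/
noncomputable def clusteringCost (n K : ℕ) : ℝ := Real.log n + n * Real.log K

theorem clusteringCost_nonneg (n K : ℕ) : 0 ≤ clusteringCost n K := by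
  have := Real.log_natCast_nonneg n
  have := Real.log_natCast_nonneg K
  unfold clusteringCost
  positivity

/-- The clusterings of `n` nodes into at least one and at most `n` labelled communities. -/
abbrev Clustering (n : ℕ) : Type := Σ K : Fin n, Fin n → Fin (K + 1)

/-- The noise `x` on the edges of a network with noiseless edge weights `p` has no unusually large
or small components in the directions which matter for the comparison of clusterings. -/
structure IsTypicalNoise {n : ℕ} (t ε : ℝ) (p x : EuclideanSpace ℝ (Edge n)) : Prop where
  norm_sq_le : ‖x‖ ^ 2 ≤ (n : ℝ) * (n - 1) / 2 * (1 + ε)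
  le_norm_sq : (n : ℝ) * (n - 1) / 4 - 2 * t ≤ ‖x‖ ^ 2
  norm_sq_starProjection_le : ∀ i : Clustering n, ‖(communitySpace i.2).starProjection x‖ ^ 2 ≤
    2 * (n * ((i.1 : ℕ) + 1 : ℕ) : ℕ) + 4 * (t + clusteringCost n (i.1 + 1))
  inner_sq_le : ∀ i : Clustering n, ⟪p - (communitySpace i.2).starProjection p, x⟫ ^ 2 ≤
    2 * (t + clusteringCost n (i.1 + 1) + Real.log 2) *
      ‖p - (communitySpace i.2).starProjection p‖ ^ 2

/-- For the selected clustering, `b` is the squared bias, `g` is `σ` times the inner product of bias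
and noise, `Y` is the squared norm of the projected noise, `D` bounds the dimension and `L` is the
clustering cost; `X` is the squared norm of the whole noise and `V = σ ^ 2`. Then `hmin` is the
minimality of the criterion, halved. -/
theorem oracle_arithmetic {b g V X Y G N Pen Pen' D L c ε t : ℝ} (hN : 0 < N) (hc : 0 < c)
    (hV : 0 ≤ V) (hb : 0 ≤ b) (hY : 0 ≤ Y) (hL : 0 ≤ L) (ht : 0 ≤ t) (hG : G = 2 * t + 4 * L)
    (hg : g ^ 2 ≤ V * G * b)
    (hmin : (b + 2 * g + V * (X - Y)) * (1 + Pen / N) ≤ V * X * (1 + Pen' / N))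
    (hX₁ : X ≤ N / 2 * (1 + ε)) (hX₂ : N / 4 - 2 * t ≤ X) (hYle : Y ≤ 2 * D + 4 * (t + L))
    (hPen' : 0 ≤ Pen') (hPen₀ : 0 ≤ Pen) (hPen₁ : Pen ≤ N)
    (hPen₂ : 24 * D + (64 + 16 / c) * L ≤ Pen) :
    (1 - c) * (2 * (b + V * Y)) ≤ V * ((32 + 4 / c) * t + (1 + ε) * Pen') := by
  have hG0 : 0 ≤ G := by rw [hG]; positivity
  -- The cross term is split in two ways: with weight one, to bound the residual below inside the
  -- penalty term, and with weight `c`, to keep `(1 - c) * b` in the main term.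
  have hg₁ := abs_le.1 (abs_two_mul_le_of_sq_le_mul (mul_nonneg hV hG0) hb hg)
  have hg₂ := abs_le.1 (abs_two_mul_le_of_sq_le_mul (u := V * (G / c)) (v := c * b)
    (by positivity) (by positivity) (by
      rw [show V * (G / c) * (c * b) = V * G * b by field_simp]
      exact hg))
  have hρ₀ : 0 ≤ Pen / N := by positivity
  have hρ₁ : Pen / N ≤ 1 := (div_le_one hN).2 hPen₁
  have hρ' : 0 ≤ Pen' / N := by positivity
  have hXρ : X * (Pen' / N) ≤ (1 + ε) / 2 * Pen' := by
    refine (mul_le_mul_of_nonneg_right hX₁ hρ').trans_eq ?_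
    field_simp
  have hrρ : V * (Pen / 4 - 2 * t - Y - G) ≤ (b + 2 * g + V * (X - Y)) * (Pen / N) := by
    have h1 : Pen / 4 - 2 * t - Y - G ≤ (X - Y - G) * (Pen / N) := by
      have h2 := mul_le_mul_of_nonneg_right hX₂ hρ₀
      have h3 : (N / 4 - 2 * t) * (Pen / N) = Pen / 4 - 2 * t * (Pen / N) := by field_simp
      have h4 := mul_le_mul_of_nonneg_left hρ₁ (by positivity : 0 ≤ 2 * t + Y + G)
      linarith
    have h5 : V * (X - Y - G) ≤ b + 2 * g + V * (X - Y) := by linarith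
    calc V * (Pen / 4 - 2 * t - Y - G) ≤ V * ((X - Y - G) * (Pen / N)) :=
          mul_le_mul_of_nonneg_left h1 hV
      _ = V * (X - Y - G) * (Pen / N) := by ring
      _ ≤ _ := mul_le_mul_of_nonneg_right h5 hρ₀
  have hVX := mul_le_mul_of_nonneg_left hXρ hV
  -- The constants come from here: `3 * Y + G + G / c` costs at most `6 * D + (16 + 4 / c) * L`,
  -- which `Pen / 4` cancels, and with `2 * t` leaves `(16 + 2 / c) * t`, doubled at the end.
  have hfin : V * ((1 + ε) / 2 * Pen' - Pen / 4 + 2 * t + 3 * Y + G + G / c) ≤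
      V * ((16 + 2 / c) * t + (1 + ε) / 2 * Pen') := by
    refine mul_le_mul_of_nonneg_left ?_ hV
    have h6 : G / c = 2 / c * t + 4 / c * L := by rw [hG]; ring
    have h7 : 16 / c * L = 4 * (4 / c * L) := by ring
    rw [h6]
    linarith
  have hcY : 0 ≤ c * (V * Y) := by positivity
  have hmin' : b + 2 * g + V * (X - Y) + (b + 2 * g + V * (X - Y)) * (Pen / N) ≤
      V * X + V * (X * (Pen' / N)) :=
    le_of_eq_of_le (by ring) (hmin.trans_eq (by ring))
  have hsum : (1 - c) * (b + V * Y) ≤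
      V * ((1 + ε) / 2 * Pen' - Pen / 4 + 2 * t + 3 * Y + G + G / c) := by
    linarith [hg₂.1]
  refine le_of_eq_of_le (by ring) ((mul_le_mul_of_nonneg_left (hsum.trans hfin)
    zero_le_two).trans_eq (by ring))

theorem penalized_estimate_le_of_isTypicalNoise {n K : ℕ} {c t ε σ : ℝ} (hn : 2 ≤ n)
    (hc : 0 < c) (hc1 : c < 1) (ht : 0 < t) (z : Fin n → Fin K)
    {p x : EuclideanSpace ℝ (Edge n)} (hp : p ∈ communitySpace z)
    (hK : IsAdmissible 6 1 (16 + 4 / c) n K) (hx : IsTypicalNoise t ε p x)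
    {P : Matrix (Fin n) (Fin n) ℝ}
    (hP : IsPenalizedEstimate 6 1 (16 + 4 / c) (networkOfEdges (p + σ • x)) P) :
    frobSq (networkOfEdges p - P) ≤
      σ ^ 2 / (1 - c) * ((32 + 4 / c) * t + (1 + ε) * penalty 6 1 (16 + 4 / c) n K) := by
  have hC₃ : 0 ≤ 16 + 4 / c := by positivity
  have hn' : (2 : ℝ) ≤ n := by exact_mod_cast hn
  have hN : (0 : ℝ) < n * (n - 1) := mul_pos (by linarith) (by linarith)
  have hpen : ∀ k, 0 ≤ penalty 6 1 (16 + 4 / c) n k := fun k =>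
    mul_nonneg (by norm_num) (complexity_nonneg (by norm_num) (by norm_num) hC₃ n k)
  obtain ⟨k, w, hw, hk, hind, hmin⟩ := hP
  rw [isInducedEstimate_networkOfEdges_iff] at hind
  obtain ⟨K', z', hKK', hz', hle⟩ := exists_surjective_communitySpace_le z
  have hmono := complexity_mono (by norm_num : (0 : ℝ) ≤ 6) zero_le_one hC₃ n hKK'
  have hcrit := hmin K' z' _ hz' (hmono.trans hK)
    ((isInducedEstimate_networkOfEdges_iff _ _ _).2 rfl)
  have hpenK : penalty 6 1 (16 + 4 / c) n K' ≤ penalty 6 1 (16 + 4 / c) n K :=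
    mul_le_mul_of_nonneg_left hmono (by norm_num)
  have hkn : k ≤ n := by simpa using Fintype.card_le_of_surjective w hw
  obtain ⟨k, rfl⟩ : ∃ j, k = j + 1 :=
    Nat.exists_eq_succ_of_ne_zero (by rintro rfl; exact (w ⟨0, by omega⟩).elim0)
  have hY := hx.norm_sq_starProjection_le ⟨⟨k, hkn⟩, w⟩
  have hg := hx.inner_sq_le ⟨⟨k, hkn⟩, w⟩
  have hL := clusteringCost_nonneg n (k + 1)
  -- Since `n ≥ 2`, the `log 2` of the two-sided tail fits into the clustering cost; hence `4 * L`
  -- rather than `2 * L` in `G`.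
  have hlog : Real.log 2 ≤ clusteringCost n (k + 1) := by
    have h1 := Real.log_le_log (by norm_num) hn'
    have h2 : 0 ≤ n * Real.log (k + 1 : ℕ) :=
      mul_nonneg (by positivity) (Real.log_natCast_nonneg _)
    unfold clusteringCost
    linarith
  simp only [] at hY hg
  have hfit : ‖p + σ • x - (communitySpace z').starProjection (p + σ • x)‖ ^ 2 ≤
      σ ^ 2 * ‖x‖ ^ 2 := by
    have h := norm_sub_sq_eq_add_of_mem (communitySpace z') (p + σ • x) (hle hp)
    rw [add_sub_cancel_left, norm_smul, mul_pow, Real.norm_eq_abs, sq_abs] at h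
    linarith [sq_nonneg ‖(communitySpace z').starProjection (p + σ • x) - p‖]
  have key := oracle_arithmetic (b := ‖p - (communitySpace w).starProjection p‖ ^ 2)
    (g := σ * ⟪p - (communitySpace w).starProjection p, x⟫) (V := σ ^ 2) (X := ‖x‖ ^ 2)
    (Y := ‖(communitySpace w).starProjection x‖ ^ 2) (N := n * (n - 1))
    (Pen := penalty 6 1 (16 + 4 / c) n (k + 1)) (Pen' := penalty 6 1 (16 + 4 / c) n K)
    (D := n * (k + 1 : ℕ)) (ε := ε)
    hN hc (sq_nonneg σ) (sq_nonneg _) (sq_nonneg _) hL ht.le rfl ?_ ?_ hx.norm_sq_le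
    hx.le_norm_sq ?_ (hpen _) (hpen _) ?_ ?_
  · rw [hind, frobSq_networkOfEdges_sub, norm_sub_starProjection_add_smul_sq, div_mul_eq_mul_div,
      le_div_iff₀ (by linarith), mul_comm]
    exact key
  · rw [mul_pow, mul_assoc]
    refine mul_le_mul_of_nonneg_left (hg.trans ?_) (sq_nonneg σ)
    exact mul_le_mul_of_nonneg_right (by linarith) (sq_nonneg _)
  · rw [hind] at hcrit
    simp only [criterion, sigmaHatSq, frobSq_networkOfEdges_sub] at hcrit
    rw [norm_add_smul_sub_starProjection_sq (communitySpace w)] at hcrit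
    have h1 := mul_le_mul_of_nonneg_right hfit
      (by have := hpen K'; positivity :
        0 ≤ 1 + penalty 6 1 (16 + 4 / c) n K' / (n * ((n : ℝ) - 1)))
    have h2 := mul_le_mul_of_nonneg_left
      (add_le_add_right (div_le_div_of_nonneg_right hpenK hN.le) 1)
      (by positivity : 0 ≤ σ ^ 2 * ‖x‖ ^ 2)
    have h3 : ∀ F Q : ℝ, 2 * F + 2 * F / (n * ((n : ℝ) - 1)) * Q =
        2 * (F * (1 + Q / (n * ((n : ℝ) - 1)))) := fun F Q => by ring
    rw [h3, h3] at hcrit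
    linarith
  · push_cast at hY ⊢
    exact hY
  · have h := hk
    unfold IsAdmissible at h
    unfold penalty
    linarith
  · unfold penalty complexity
    -- The `K ^ 2 * log n` term is only dropped, so its coefficient `1` is an arbitrary choice.
    have h1 : 0 ≤ 1 * ((k + 1 : ℕ) : ℝ) ^ 2 * Real.log n :=
      mul_nonneg (by positivity) (Real.log_natCast_nonneg n)
    have h2 : (64 + 16 / c) * clusteringCost n (k + 1) =
      4 * ((16 + 4 / c) * (Real.log n + n * Real.log (k + 1 : ℕ))) := by
      unfold clusteringCost
      ring
    linarith

/-! ### Probability of typical noise -/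

/-- Kraft's equality: each of the `n` possible numbers of communities carries total weight `1 / n`,
shared equally by its `K ^ n` labelled clusterings. -/
theorem sum_exp_neg_clusteringCost {n : ℕ} (hn : n ≠ 0) (t : ℝ) :
    ∑ i : Clustering n, Real.exp (-(t + clusteringCost n (i.1 + 1))) = Real.exp (-t) := by
  have hn' : (0 : ℝ) < n := by exact_mod_cast Nat.pos_of_ne_zero hn
  have h : ∀ k : ℕ, Real.exp (-(t + clusteringCost n (k + 1))) =
      Real.exp (-t) * ((n : ℝ)⁻¹ * (((k + 1 : ℕ) : ℝ) ^ n)⁻¹) := fun k => by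
    rw [clusteringCost, neg_add, neg_add, Real.exp_add, Real.exp_add, Real.exp_neg (Real.log n),
      Real.exp_log hn', Real.exp_neg (n * _), Real.exp_nat_mul, Real.exp_log (by positivity)]
  rw [Fintype.sum_sigma]
  simp only [h, Finset.sum_const, Finset.card_univ, Fintype.card_pi, Fintype.card_fin,
    Finset.prod_const, nsmul_eq_mul]
  have h2 : ∀ k : Fin n, (((k : ℕ) + 1) ^ n : ℕ) *
      (Real.exp (-t) * ((n : ℝ)⁻¹ * ((((k : ℕ) + 1 : ℕ) : ℝ) ^ n)⁻¹)) =
      Real.exp (-t) * (n : ℝ)⁻¹ := fun k => by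
    push_cast
    have : ((k : ℕ) + 1 : ℝ) ≠ 0 := by positivity
    field_simp
  rw [Finset.sum_congr rfl fun k _ => h2 k]
  simp only [Finset.sum_const, Finset.card_univ, Fintype.card_fin, nsmul_eq_mul]
  field_simp

theorem prod_real_le_of_forall_real_le {α β : Type*} [MeasurableSpace α] [MeasurableSpace β]
    {μ : Measure α} {ν : Measure β} [IsProbabilityMeasure μ] [IsProbabilityMeasure ν]
    {s : Set (α × β)} (hs : MeasurableSet s) {r : ℝ} (hr : 0 ≤ r)
    (h : ∀ x, ν.real (Prod.mk x ⁻¹' s) ≤ r) : (μ.prod ν).real s ≤ r := by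
  refine ENNReal.toReal_le_of_le_ofReal hr ?_
  rw [Measure.prod_apply hs]
  refine (lintegral_mono (g := fun _ => ENNReal.ofReal r) fun x => ?_).trans (by simp)
  rw [← ofReal_measureReal]
  exact ENNReal.ofReal_le_ofReal (h x)

theorem map_real_apply_of_aemeasurable {α β : Type*} [MeasurableSpace α] [MeasurableSpace β]
    {μ : Measure α} {f : α → β} (hf : AEMeasurable f μ) {s : Set β} (hs : MeasurableSet s) :
    (μ.map f).real s = μ.real (f ⁻¹' s) := by
  rw [measureReal_def, measureReal_def, Measure.map_apply_of_aemeasurable hf hs]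

theorem finrank_euclideanSpace_edge (n : ℕ) :
    (Module.finrank ℝ (EuclideanSpace ℝ (Edge n)) : ℝ) = n * (n - 1) / 2 := by
  rw [finrank_euclideanSpace, Sym2.card_subtype_not_diag, Fintype.card_fin, Nat.cast_choose_two]

/-- One `exp (-t)` each comes from the lower norm bound, from all projections together and from all
inner products together; the last term comes from the upper norm bound. -/
theorem measureReal_not_isTypicalNoise_le {Ω : Type*} [MeasurableSpace Ω] {μ : Measure Ω}
    [IsProbabilityMeasure μ] {n : ℕ} {p x : Ω → EuclideanSpace ℝ (Edge n)} (hn : 2 ≤ n) {t ε : ℝ} (ht : 0 ≤ t) (hε₀ : 0 ≤ ε)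
    (hε₁ : ε ≤ 1 / 2) (hp : AEMeasurable p μ) (hx : AEMeasurable x μ)
    (hlaw : μ.map x = stdGaussian (EuclideanSpace ℝ (Edge n))) (hind : IndepFun p x μ) :
    μ.real {ω | ¬ IsTypicalNoise t ε (p ω) (x ω)} ≤
      3 * Real.exp (-t) + Real.exp (-(3 / 32 * ε ^ 2 * ((n : ℝ) * ((n : ℝ) - 1)))) := by
  have hdim := finrank_euclideanSpace_edge n
  have hB₁ : μ.real {ω | (n : ℝ) * (n - 1) / 2 * (1 + ε) ≤ ‖x ω‖ ^ 2} ≤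
      Real.exp (-(3 / 32 * ε ^ 2 * ((n : ℝ) * ((n : ℝ) - 1)))) := by
    have h := stdGaussian_real_norm_sq_ge_le (E := EuclideanSpace ℝ (Edge n)) hε₀ hε₁
    rw [← hlaw, map_real_apply_of_aemeasurable hx (measurableSet_le (by fun_prop) (by fun_prop)),
      hdim] at h
    exact h.trans_eq (by ring_nf)
  have hB₂ : μ.real {ω | ‖x ω‖ ^ 2 ≤ (n : ℝ) * (n - 1) / 4 - 2 * t} ≤ Real.exp (-t) := by
    have h := stdGaussian_real_norm_sq_le_le (E := EuclideanSpace ℝ (Edge n)) t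
    rw [← hlaw, map_real_apply_of_aemeasurable hx (measurableSet_le (by fun_prop) (by fun_prop)),
      hdim, show (n : ℝ) * (n - 1) / 2 / 2 = n * (n - 1) / 4 by ring] at h
    exact h
  have hB₃ : ∀ i : Clustering n, μ.real {ω | 2 * (n * ((i.1 : ℕ) + 1 : ℕ) : ℕ) +
      4 * (t + clusteringCost n (i.1 + 1)) ≤ ‖(communitySpace i.2).starProjection (x ω)‖ ^ 2} ≤
      Real.exp (-(t + clusteringCost n (i.1 + 1))) := fun i => by
    have h := stdGaussian_real_norm_sq_orthogonalProjectionOnto_ge_le (communitySpace i.2)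
      (finrank_communitySpace_le i.2) (t + clusteringCost n (i.1 + 1))
    rw [← hlaw, map_real_apply_of_aemeasurable hx
      (measurableSet_le (by fun_prop) (by fun_prop))] at h
    exact h
  have hB₄ : ∀ i : Clustering n, μ.real {ω | 2 * (t + clusteringCost n (i.1 + 1) + Real.log 2) *
      ‖p ω - (communitySpace i.2).starProjection (p ω)‖ ^ 2 <
        ⟪p ω - (communitySpace i.2).starProjection (p ω), x ω⟫ ^ 2} ≤
      Real.exp (-(t + clusteringCost n (i.1 + 1))) := fun i => by
    have hw : 0 ≤ t + clusteringCost n (i.1 + 1) + Real.log 2 := by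
      have := clusteringCost_nonneg n (i.1 + 1)
      have := Real.log_pos one_lt_two
      positivity
    have hs : MeasurableSet {y : EuclideanSpace ℝ (Edge n) × EuclideanSpace ℝ (Edge n) |
         2 * (t + clusteringCost n (i.1 + 1) + Real.log 2) *
        ‖y.1 - (communitySpace i.2).starProjection y.1‖ ^ 2 <
          ⟪y.1 - (communitySpace i.2).starProjection y.1, y.2⟫ ^ 2} :=
      measurableSet_lt (by fun_prop) (by fun_prop)
    have := Measure.isProbabilityMeasure_map hp
    -- Independence allows the bias to be frozen while the noise is integrated out; the `log 2` in
    -- the threshold cancels the factor `2` of the two-sided tail.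
    have h := prod_real_le_of_forall_real_le (μ := μ.map p) (ν := stdGaussian _) hs
      (by positivity) fun y => stdGaussian_real_inner_sq_gt_le
        (y - (communitySpace i.2).starProjection y) hw
    rw [← hlaw, ← hind.map_prod_eq_prod_map_map hp hx,
      map_real_apply_of_aemeasurable (hp.prodMk hx) hs, neg_add, Real.exp_add,
      Real.exp_neg (Real.log 2), Real.exp_log two_pos] at h
    exact h.trans_eq (by ring)
  have hsub : {ω | ¬ IsTypicalNoise t ε (p ω) (x ω)} ⊆
      (({ω | (n : ℝ) * (n - 1) / 2 * (1 + ε) ≤ ‖x ω‖ ^ 2} ∪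
        {ω | ‖x ω‖ ^ 2 ≤ (n : ℝ) * (n - 1) / 4 - 2 * t}) ∪
      (⋃ i : Clustering n, {ω | 2 * (n * ((i.1 : ℕ) + 1 : ℕ) : ℕ) +
        4 * (t + clusteringCost n (i.1 + 1)) ≤
          ‖(communitySpace i.2).starProjection (x ω)‖ ^ 2})) ∪
      ⋃ i : Clustering n, {ω | 2 * (t + clusteringCost n (i.1 + 1) + Real.log 2) *
        ‖p ω - (communitySpace i.2).starProjection (p ω)‖ ^ 2 <
          ⟪p ω - (communitySpace i.2).starProjection (p ω), x ω⟫ ^ 2} := by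
    intro ω hω
    by_contra hcon
    simp only [Set.mem_union, Set.mem_ofPred_eq, Set.mem_iUnion, not_or, not_exists, not_le,
      not_lt] at hcon
    exact hω ⟨hcon.1.1.1.le, hcon.1.1.2.le, fun i => (hcon.1.2 i).le, hcon.2⟩
  have hsum := sum_exp_neg_clusteringCost (by omega : n ≠ 0) t
  refine (measureReal_mono hsub).trans ?_
  refine (measureReal_union_le _ _).trans ?_
  have hU := measureReal_union_le (μ := μ)
    ({ω | (n : ℝ) * (n - 1) / 2 * (1 + ε) ≤ ‖x ω‖ ^ 2} ∪
      {ω | ‖x ω‖ ^ 2 ≤ (n : ℝ) * (n - 1) / 4 - 2 * t})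
    (⋃ i : Clustering n, {ω | 2 * (n * ((i.1 : ℕ) + 1 : ℕ) : ℕ) +
        4 * (t + clusteringCost n (i.1 + 1)) ≤
          ‖(communitySpace i.2).starProjection (x ω)‖ ^ 2})
  have hU' := measureReal_union_le (μ := μ)
    {ω | (n : ℝ) * (n - 1) / 2 * (1 + ε) ≤ ‖x ω‖ ^ 2}
    {ω | ‖x ω‖ ^ 2 ≤ (n : ℝ) * (n - 1) / 4 - 2 * t}
  have h₃ := (measureReal_iUnion_fintype_le (μ := μ) _).trans
    ((Finset.sum_le_sum fun i _ => hB₃ i).trans_eq hsum)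
  have h₄ := (measureReal_iUnion_fintype_le (μ := μ) _).trans
    ((Finset.sum_le_sum fun i _ => hB₄ i).trans_eq hsum)
  linarith
-- Transfer to the random network
theorem IsNormalLSMInput.map_error_eq_stdGaussian {Ω : Type*} [MeasurableSpace Ω] {μ : Measure Ω}
    [IsProbabilityMeasure μ] {n K : ℕ} {Z : Fin n → Fin K → Ω → ℝ} {ξ : Sym2 (Fin n) → Ω → ℝ}
    (h : IsNormalLSMInput μ Z ξ) :
    μ.map (fun ω => toLp 2 fun e : Edge n => ξ e.1 ω) =
      stdGaussian (EuclideanSpace ℝ (Edge n)) := by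
  have hm : ∀ e : Edge n, AEMeasurable (ξ e.1) μ := fun e => (h.error_law e.1 e.2).aemeasurable
  have h1 := (iIndepFun_iff_map_fun_eq_pi_map hm).1 h.error_indep
  simp_rw [fun e : Edge n => (h.error_law e.1 e.2).map_eq] at h1
  rw [← map_pi_eq_stdGaussian, ← h1, AEMeasurable.map_map_of_aemeasurable
    (Measurable.aemeasurable (by fun_prop)) (aemeasurable_pi_lambda _ hm)]
  rfl

theorem measurable_communityEdges_sociabilityCoeff {n K : ℕ} (z : Fin n → Fin K)
    (γ : Sym2 (Fin K) → ℝ) (α : Fin K → Fin K → ℝ) :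
    Measurable fun Z => communityEdges z (sociabilityCoeff z γ α Z) := by
  refine (communityEdges z).continuous_of_finiteDimensional.measurable.comp ?_
  unfold sociabilityCoeff
  fun_prop

theorem frobSq_eq_zero_of_le_one {n : ℕ} (hn : n ≤ 1)
    (M : Matrix (Fin n) (Fin n) ℝ) (hM : ∀ u, M u u = 0) : frobSq M = 0 := by
  have : Subsingleton (Fin n) := Fin.subsingleton_iff_le_one.2 hn
  refine Finset.sum_eq_zero fun u _ => Finset.sum_eq_zero fun v _ => ?_
  rw [Subsingleton.elim v u, hM, zero_pow two_ne_zero]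

/-- The inputs are only almost everywhere measurable, so the bad event need not be measurable; the
complement of its measurable hull serves instead. -/
theorem exists_measurableSet_of_measureReal_not_le {Ω : Type*} [MeasurableSpace Ω] {μ : Measure Ω}
    [IsProbabilityMeasure μ] {P : Ω → Prop} {r : ℝ} (h : μ.real {ω | ¬ P ω} ≤ r) :
    ∃ E, MeasurableSet E ∧ 1 - r ≤ μ.real E ∧ ∀ ω ∈ E, P ω := by
  refine ⟨(toMeasurable μ {ω | ¬ P ω})ᶜ, (measurableSet_toMeasurable _ _).compl, ?_, ?_⟩
  · rw [probReal_compl_eq_one_sub (measurableSet_toMeasurable _ _), measureReal_def,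
      measure_toMeasurable, ← measureReal_def]
    linarith
  · intro ω hω
    by_contra hP
    exact hω (subset_toMeasurable _ _ hP)

/-- `Kstar` is the true number of communities, `A ω` the observed network, `Pstar ω` the network
with the same generating process and `σ` set to `0`, and `E` the event of the given probability. -/
theorem theorem2 :
    ∃ C₁ > (0 : ℝ), ∃ C₂ > (0 : ℝ), ∀ c : ℝ, 0 < c → c < 1 →
    ∃ C₃ > (0 : ℝ), ∃ C > (0 : ℝ),
    ∀ (Ω : Type*) [MeasurableSpace Ω] (μ : MeasureTheory.Measure Ω)
      [MeasureTheory.IsProbabilityMeasure μ]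
      (n Kstar : ℕ) (zstar : Fin n → Fin Kstar)
      (γ : Sym2 (Fin Kstar) → ℝ) (α : Fin Kstar → Fin Kstar → ℝ) (σ : ℝ)
      (Z : Fin n → Fin Kstar → Ω → ℝ) (ξ : Sym2 (Fin n) → Ω → ℝ)
      (A Pstar : Ω → Matrix (Fin n) (Fin n) ℝ),
      0 ≤ σ →
      IsNormalLSMInput μ Z ξ →
      (∀ ω, A ω = lsmNetwork zstar γ α (fun u j => Z u j ω) σ (fun e => ξ e ω)) →
      (∀ ω, Pstar ω = lsmNetwork zstar γ α (fun u j => Z u j ω) 0 (fun e => ξ e ω)) →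
      IsAdmissible C₁ C₂ C₃ n Kstar →
      ∀ t ε : ℝ, 0 < t → 0 ≤ ε → ε < 1 / 2 →
      ∃ E : Set Ω, MeasurableSet E ∧
        1 - 3 * Real.exp (-t) - Real.exp (-(3 / 32 * ε ^ 2 * ((n : ℝ) * ((n : ℝ) - 1)))) ≤
          μ.real E ∧
        ∀ ω ∈ E, ∀ Phat : Matrix (Fin n) (Fin n) ℝ, IsPenalizedEstimate C₁ C₂ C₃ (A ω) Phat →
          frobSq (Pstar ω - Phat) ≤
            σ ^ 2 / (1 - c) * (C * t + (1 + ε) * penalty C₁ C₂ C₃ n Kstar) := by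
  refine ⟨6, by norm_num, 1, one_pos, fun c hc hc1 => ⟨16 + 4 / c, by positivity, 32 + 4 / c,
    by positivity, ?_⟩⟩
  intro Ω _ μ _ n K z γ α σ Z ξ A Pstar _ hin hA hPstar hK t ε ht hε₀ hε₁
  -- With at most one node there are no edges: `n * (n - 1)` vanishes, but so does the loss.
  rcases Nat.lt_or_ge n 2 with hn | hn
  · refine ⟨Set.univ, MeasurableSet.univ, ?_, fun ω _ P hP => ?_⟩
    · rw [probReal_univ]
      linarith [Real.exp_nonneg (-t),
        Real.exp_nonneg (-(3 / 32 * ε ^ 2 * ((n : ℝ) * ((n : ℝ) - 1))))]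
    · obtain ⟨k, w, _, _, ⟨⟨γ', α', Z', rfl⟩, _⟩, _⟩ := hP
      have hpen : 0 ≤ penalty 6 1 (16 + 4 / c) n K :=
        mul_nonneg (by norm_num)
          (complexity_nonneg (by norm_num) (by norm_num) (by positivity) n K)
      have hc1' : 0 < 1 - c := by linarith
      rw [hPstar, frobSq_eq_zero_of_le_one (by omega) _ fun u => by simp [lsmNetwork]]
      positivity
  · set f := fun Z => communityEdges z (sociabilityCoeff z γ α Z)
    have hf : Measurable f := measurable_communityEdges_sociabilityCoeff z γ α
    have hZ : AEMeasurable (fun ω u j => Z u j ω) μ :=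
      aemeasurable_pi_lambda _ fun u => aemeasurable_pi_lambda _ fun j =>
        (hin.sociability_law u j).aemeasurable
    have hξ : AEMeasurable (fun ω => toLp 2 fun e : Edge n => ξ e.1 ω) μ :=
      (WithLp.measurable_toLp 2 _).comp_aemeasurable
        (aemeasurable_pi_lambda _ fun e => (hin.error_law e.1 e.2).aemeasurable)
    have hind := hin.sociability_error_indep.comp hf (WithLp.measurable_toLp 2 (Edge n → ℝ))
    obtain ⟨E, hE, hμE, htyp⟩ := exists_measurableSet_of_measureReal_not_le
      (measureReal_not_isTypicalNoise_le hn ht.le hε₀ hε₁.le (hf.comp_aemeasurable hZ) hξ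
        hin.map_error_eq_stdGaussian hind)
    refine ⟨E, hE, by linarith, fun ω hω P hP => ?_⟩
    rw [hA, lsmNetwork_eq_networkOfEdges] at hP
    rw [hPstar, lsmNetwork_eq_networkOfEdges, zero_smul, add_zero]
    exact penalized_estimate_le_of_isTypicalNoise hn hc hc1 ht z (LinearMap.mem_range_self _ _) hK
      (htyp ω hω) hP
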